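/- Let $d\ge 1$ and let $P\subset\mathbb{R}^d$ be a convex polytope, i.e. the convex hull of a finite set of points, with positive Lebesgue measure. Suppose that $P$ is simple (each vertex is joined by an edge of $P$ to exactly $d$ other vertices) and rational (all vertices have rational coordinates). For a countable set $\Lambda\subset\mathbb{R}^d$, call $E(\Lambda)=\{e^{i\langle\lambda,\cdot\rangle}\}_{\lambda\in\Lambda}$ a set of orthogonal exponentials for $P$ if $\int_P e^{i\langle\lambda,x\rangle}\overline{e^{i\langle\lambda',x\rangle}}\,dx=0$ for all distinct $\lambda,\lambda'\in\Lambda$. Then there is an infinite $\Lambda\subset\mathbb{R}^d$ such that $E(\Lambda)$ is a set of orthogonal exponentials for $P$. Moreover, such a $\Lambda$ is constructed greedily as follows. The set $\mathcal{H}$ of hyperplanes through the origin that are orthogonal to some edge of $P$ is finite, and the coordinates of the vertices of $P$ have a common denominator. Let $n\ge1$ be any common denominator of these coordinates, and let $L=2\pi n\mathbb{Z}^d$. 1. For every finite $F\subset L$, the set $L\setminus\bigcup_{y\in F}\bigcup_{H\in\mathcal{H}}(y+H)$ of admissible next points is infinite. 2. There is a sequence $x_0=0,x_1,x_2,\dots$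 in $L$ such that, for every $k\ge 1$, $x_k\notin x_j+H$ for all $j<k$ and all $H\in\mathcal{H}$. 3. For every sequence $x_0,x_1,x_2,\dots$ in $L$ such that, for every $k\ge 1$, $x_k\notin x_j+H$ for all $j<k$ and all $H\in\mathcal{H}$, the points $x_k$ are pairwise distinct and $E(\{x_0,x_1,x_2,\dots\})$ is a set of orthogonal exponentials for $P$. -/

import Mathlib

open scoped ComplexConjugate

namespace PolytopeExp

/-- Euclidean space of dimension `d`. -/
abbrev Euc (d : ℕ) : Type := EuclideanSpace ℝ (Fin d)

/-- A convex polytope: the convex hull of finitely many points, of positive Lebesgue measure. -/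
def IsConvexPolytope {d : ℕ} (P : Set (Euc d)) : Prop :=
  (∃ S : Set (Euc d), S.Finite ∧ P = convexHull ℝ S) ∧ 0 < MeasureTheory.volume P

/-- The vertices of `P`. -/
def vertices {d : ℕ} (P : Set (Euc d)) : Set (Euc d) := Set.extremePoints ℝ P

/-- Two distinct vertices are connected (adjacent) if the segment joining them is an edge of `P`,
i.e. a one-dimensional face, where a face is the set of maximizers on `P` of a linear
functional. -/
def Adjacent {d : ℕ} (P : Set (Euc d)) (v w : Euc d) : Prop :=
  v ∈ vertices P ∧ w ∈ vertices P ∧ v ≠ w ∧ IsExposed ℝ P (segment ℝ v w)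

/-- `P` is simple: each vertex is connected to exactly `d` other vertices. -/
def IsSimple {d : ℕ} (P : Set (Euc d)) : Prop :=
  ∀ v ∈ vertices P, {w : Euc d | Adjacent P v w}.encard = d

/-- `P` is rational: the vertices have rational components. -/
def IsRational {d : ℕ} (P : Set (Euc d)) : Prop :=
  ∀ v ∈ vertices P, ∀ i : Fin d, ∃ q : ℚ, v i = (q : ℝ)

/-- `E(Λ)` is a set of orthogonal exponentials for `D`. -/
def IsOrthogonalExponentials {d : ℕ} (D Λ : Set (Euc d)) : Prop :=
  Λ.Countable ∧ ∀ a ∈ Λ, ∀ b ∈ Λ, a ≠ b →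
    ∫ x in D, Complex.exp (Complex.I * ((inner ℝ a x : ℝ) : ℂ)) *
      conj (Complex.exp (Complex.I * ((inner ℝ b x : ℝ) : ℂ))) = 0

/-- The positive integer `n` is a common denominator of the components of the vertices of `P`. -/
def IsCommonDenominator {d : ℕ} (P : Set (Euc d)) (n : ℕ) : Prop :=
  0 < n ∧ ∀ v ∈ vertices P, ∀ i : Fin d, ∃ m : ℤ, v i = (m : ℝ) / (n : ℝ)

/-- The lattice `2πn ℤ^d`. -/
def scaledLattice (d n : ℕ) : Set (Euc d) :=
  {x | ∀ i : Fin d, ∃ k : ℤ, x i = 2 * Real.pi * (n : ℝ) * (k : ℝ)}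

/-- The hyperplanes through the origin that are orthogonal to an edge of `P`. -/
def edgeHyperplanes {d : ℕ} (P : Set (Euc d)) : Set (Set (Euc d)) :=
  {H | ∃ v w : Euc d, Adjacent P v w ∧ H = {ω : Euc d | inner ℝ (w - v) ω = 0}}

/-- The points that may be picked after the points of `F`: the lattice points outside
`y + H` for every `y ∈ F` and every hyperplane `H` orthogonal to an edge of `P`. -/
def admissible {d : ℕ} (P : Set (Euc d)) (n : ℕ) (F : Set (Euc d)) : Set (Euc d) :=
  {x | x ∈ scaledLattice d n ∧ ∀ y ∈ F, ∀ H ∈ edgeHyperplanes P, x - y ∉ H}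

/-- A sequence picked greedily: each term is admissible with respect to all earlier terms. -/
def IsGreedy {d : ℕ} (P : Set (Euc d)) (n : ℕ) (x : ℕ → Euc d) : Prop :=
  ∀ k : ℕ, x k ∈ admissible P n {y | ∃ j < k, x j = y}

end PolytopeExp

/-! The heart is `setIntegral_exp_eq_zero`: if a linear form `ω` separates the endpoints of every
edge of a polytope and `exp (i ω)` takes one value at all vertices, then `exp (i ω)` integrates to
zero. The proof is by induction on dimension. With `ω` as vertical coordinate, integrating along
fibers leaves `(exp (i · upper) - exp (i · lower)) / i` over the shadow. Both boundaries are
piecewise affine, each piece lying over the projection of a facet, and vertices and edges of such a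
projection lift to vertices and edges of the polytope. So each piece inherits the hypotheses one
dimension lower, and both terms vanish. In dimension one, the two terms cancel because the endpoints
are vertices.

A difference `z` of points of a greedy sequence lies in `2πn ℤ^d`, hence pairs with every vertex to
a multiple of `2π`, and lies on no edge hyperplane, so the form `⟨z, ·⟩` qualifies. Greedy choice
never gets stuck: lattice points on the moment curve meet each translated hyperplane finitely often.
-/

namespace PolytopeExp

open MeasureTheory

/-! ### Faces cut out by affine graphs, and the upper boundary -/

section Facets

variable {E V : Type*} [NormedAddCommGroup E] [NormedSpace ℝ E]
  [NormedAddCommGroup V] [NormedSpace ℝ V]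

/-- `v` and `w` are the endpoints of an edge of the convex set `P`. -/
def IsEdge (P : Set E) (v w : E) : Prop :=
  v ∈ P.extremePoints ℝ ∧ w ∈ P.extremePoints ℝ ∧ v ≠ w ∧ IsExposed ℝ P (segment ℝ v w)

/-- The height of the graph of the affine function `h` above the point `x`, where `e` splits the
space into a base and a vertical coordinate. -/
def gap (e : E ≃L[ℝ] V × ℝ) (h : StrongDual ℝ V × ℝ) (x : E) : ℝ :=
  h.1 (e x).1 + h.2 - (e x).2

/-- The graph map of the affine function `h`. -/
noncomputable def graphMap (e : E ≃L[ℝ] V × ℝ) (h : StrongDual ℝ V × ℝ) : V →ᵃ[ℝ] E :=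
  ((e.symm : V × ℝ →L[ℝ] E).comp ((ContinuousLinearMap.id ℝ V).prod h.1)).toLinearMap.toAffineMap
    + AffineMap.const ℝ V (e.symm (0, h.2))

/-- The base projections of the points of `S` on the graph of `h`. -/
def contact (S : Set E) (e : E ≃L[ℝ] V × ℝ) (h : StrongDual ℝ V × ℝ) : Set V :=
  (fun x => (e x).1) '' {s | s ∈ S ∧ gap e h s = 0}

/-- The height of the upper boundary of `P`. -/
noncomputable def upper (P : Set E) (e : E ≃L[ℝ] V × ℝ) (y : V) : ℝ :=
  sSup {t | e.symm (y, t) ∈ P}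

/-- The projection of `P` to the base. -/
def shadow (P : Set E) (e : E ≃L[ℝ] V × ℝ) : Set V := (fun x => (e x).1) '' P

variable {S P : Set E} {e : E ≃L[ℝ] V × ℝ} {h : StrongDual ℝ V × ℝ}

theorem graphMap_apply (y : V) : graphMap e h y = e.symm (y, h.1 y + h.2) := by
  simp [graphMap, ← map_add]

theorem apply_graphMap (y : V) : e (graphMap e h y) = (y, h.1 y + h.2) := by
  simp [graphMap_apply]

theorem gap_graphMap (y : V) : gap e h (graphMap e h y) = 0 := by
  simp [gap, apply_graphMap]

theorem graphMap_of_gap_eq_zero {x : E} (hx : gap e h x = 0) : graphMap e h (e x).1 = x := by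
  rw [graphMap_apply, e.symm_apply_eq]
  refine Prod.ext rfl ?_
  unfold gap at hx
  simp only
  linarith

theorem gap_combo {a b : ℝ} (hab : a + b = 1) (x y : E) :
    gap e h (a • x + b • y) = a * gap e h x + b * gap e h y := by
  simp only [gap, map_add, map_smul, Prod.fst_add, Prod.snd_add, Prod.smul_fst, Prod.smul_snd,
    smul_eq_mul]
  linear_combination (-h.2) * hab

theorem gap_nonneg (hS : ∀ s ∈ S, 0 ≤ gap e h s) {x : E} (hx : x ∈ convexHull ℝ S) :
    0 ≤ gap e h x := by
  refine convexHull_min (t := {x | 0 ≤ gap e h x}) hS ?_ hx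
  intro x hx y hy a b ha hb hab
  simp only [Set.mem_ofPred_eq] at *
  rw [gap_combo hab]
  positivity

theorem convex_shadow (hP : Convex ℝ P) : Convex ℝ (shadow P e) :=
  hP.linear_image ((LinearMap.fst ℝ V ℝ).comp e.toLinearEquiv.toLinearMap)

/-- A nonnegative affine function vanishing at a convex combination vanishes at every point with
positive weight. -/
theorem fst_mem_convexHull_contact (hS : ∀ s ∈ S, 0 ≤ gap e h s) {x : E}
    (hx : x ∈ convexHull ℝ S) (h0 : gap e h x = 0) :
    (e x).1 ∈ convexHull ℝ (contact S e h) := by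
  have key : x ∈ {x | 0 ≤ gap e h x ∧ (gap e h x = 0 → (e x).1 ∈ convexHull ℝ (contact S e h))} := by
    refine convexHull_min ?_ ?_ hx
    · intro s hs
      exact ⟨hS s hs, fun h0 => subset_convexHull ℝ _ ⟨s, ⟨hs, h0⟩, rfl⟩⟩
    · rintro x ⟨hx, hx'⟩ y ⟨hy, hy'⟩ a b ha hb hab
      have hg := gap_combo (e := e) (h := h) hab x y
      refine ⟨by rw [hg]; positivity, fun h0 => ?_⟩
      rw [hg] at h0
      have h1 := mul_nonneg ha hx
      have h2 := mul_nonneg hb hy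
      have h1' : a * gap e h x = 0 := by linarith
      have h2' : b * gap e h y = 0 := by linarith
      rcases mul_eq_zero.1 h1' with ha0 | hx0
      · obtain rfl : b = 1 := by linarith
        subst ha0
        simpa using hy' (by linarith)
      rcases mul_eq_zero.1 h2' with hb0 | hy0
      · obtain rfl : a = 1 := by linarith
        subst hb0
        simpa using hx' (by linarith)
      have := convex_convexHull ℝ (contact S e h) (hx' hx0) (hy' hy0) ha hb hab
      simpa using this
  exact key.2 h0

theorem graphMap_mem {y : V} (hy : y ∈ convexHull ℝ (contact S e h)) :
    graphMap e h y ∈ convexHull ℝ S := by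
  refine convexHull_min (t := graphMap e h ⁻¹' convexHull ℝ S) ?_
    ((convex_convexHull ℝ S).affine_preimage _) hy
  rintro _ ⟨s, ⟨hs, h0⟩, rfl⟩
  rw [Set.mem_preimage, graphMap_of_gap_eq_zero h0]
  exact subset_convexHull ℝ S hs

theorem convexHull_contact_subset : convexHull ℝ (contact S e h) ⊆ shadow (convexHull ℝ S) e :=
  fun y hy => ⟨_, graphMap_mem hy, by simp [apply_graphMap]⟩

theorem graphMap_mem_extremePoints (hS : ∀ s ∈ S, 0 ≤ gap e h s) {v : V}
    (hv : v ∈ (convexHull ℝ (contact S e h)).extremePoints ℝ) :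
    graphMap e h v ∈ (convexHull ℝ S).extremePoints ℝ := by
  rw [mem_extremePoints] at hv ⊢
  refine ⟨graphMap_mem hv.1, ?_⟩
  rintro x hx y hy ⟨a, b, ha, hb, hab, hc⟩
  have hg := gap_combo (e := e) (h := h) hab x y
  rw [hc, gap_graphMap] at hg
  have h1 := gap_nonneg hS hx
  have h2 := gap_nonneg hS hy
  have hx0 : gap e h x = 0 := by
    have := mul_nonneg ha.le h1
    have := mul_nonneg hb.le h2
    exact (mul_eq_zero.1 (by linarith : a * gap e h x = 0)).resolve_left ha.ne'
  have hy0 : gap e h y = 0 := by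
    have := mul_nonneg ha.le h1
    have := mul_nonneg hb.le h2
    exact (mul_eq_zero.1 (by linarith : b * gap e h y = 0)).resolve_left hb.ne'
  obtain ⟨e1, e2⟩ := hv.2 _ (fst_mem_convexHull_contact hS hx hx0) _
    (fst_mem_convexHull_contact hS hy hy0) ⟨a, b, ha, hb, hab, by
      have := congrArg (fun z => (e z).1) hc
      simpa [apply_graphMap] using this⟩
  rw [← graphMap_of_gap_eq_zero hx0, ← graphMap_of_gap_eq_zero hy0, e1, e2]
  exact ⟨rfl, rfl⟩

/-- A functional exposing the edge inside the face is extended to the whole polytope by subtracting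
a large multiple of `gap`, which penalizes leaving the face. -/
theorem isEdge_graphMap (hfin : S.Finite) (hS : ∀ s ∈ S, 0 ≤ gap e h s) {v w : V}
    (hvw : IsEdge (convexHull ℝ (contact S e h)) v w) :
    IsEdge (convexHull ℝ S) (graphMap e h v) (graphMap e h w) := by
  obtain ⟨hv, hw, hne, hexp⟩ := hvw
  refine ⟨graphMap_mem_extremePoints hS hv, graphMap_mem_extremePoints hS hw, ?_, fun _ => ?_⟩
  · intro heq
    have := congrArg (fun z => (e z).1) heq
    exact hne (by simpa [apply_graphMap] using this)
  obtain ⟨m, hm⟩ := hexp ⟨v, left_mem_segment ℝ v w⟩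
  have hvm := hm.subset (left_mem_segment ℝ v w)
  -- Finitely many ratios are bounded; where the gap is zero, `v` already maximizes `m`.
  obtain ⟨N, hN⟩ : ∃ N : ℝ, ∀ s ∈ S, m (e s).1 - m v ≤ N * gap e h s := by
    obtain ⟨N, hN⟩ := (hfin.image fun s => (m (e s).1 - m v) / gap e h s).bddAbove
    refine ⟨N, fun s hs => ?_⟩
    rcases (hS s hs).eq_or_lt with h0 | h0
    · rw [← h0, mul_zero, sub_nonpos]
      exact hvm.2 _ (subset_convexHull ℝ _ ⟨s, ⟨hs, h0.symm⟩, rfl⟩)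
    · exact (div_le_iff₀ h0).1 (hN ⟨s, hs, rfl⟩)
  have hN' : ∀ x ∈ convexHull ℝ S, m (e x).1 - m v ≤ N * gap e h x := by
    intro x hx
    refine convexHull_min (t := {x | m (e x).1 - m v ≤ N * gap e h x}) hN ?_ hx
    intro x hx y hy a b ha hb hab
    simp only [Set.mem_ofPred_eq] at hx hy ⊢
    rw [gap_combo hab]
    simp only [map_add, map_smul, Prod.fst_add, Prod.smul_fst, smul_eq_mul]
    obtain rfl : b = 1 - a := by linarith
    nlinarith [mul_le_mul_of_nonneg_left hx ha, mul_le_mul_of_nonneg_left hy hb]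
  -- The slope `N + 1`, rather than `N`, makes the inequality strict off the graph, so maximizers
  -- have zero gap.
  set l : StrongDual ℝ E := m.comp ((ContinuousLinearMap.fst ℝ V ℝ).comp e.toContinuousLinearMap)
    - (N + 1) • ((h.1.comp ((ContinuousLinearMap.fst ℝ V ℝ).comp e.toContinuousLinearMap))
      - (ContinuousLinearMap.snd ℝ V ℝ).comp e.toContinuousLinearMap) with hl
  have hl' : ∀ x, l x = m (e x).1 - (N + 1) * gap e h x + (N + 1) * h.2 := by
    intro x
    simp [hl, gap]
    ring
  refine ⟨l, ?_⟩
  rw [← image_segment ℝ (graphMap e h) v w]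
  ext x
  simp only [Set.mem_ofPred_eq]
  constructor
  · rintro ⟨y, hy, rfl⟩
    have hy' := hm.subset hy
    refine ⟨graphMap_mem hy'.1, fun z hz => ?_⟩
    have h1 := hN' z hz
    have h2 := gap_nonneg hS hz
    have h3 := hy'.2 v hvm.1
    rw [hl', hl', gap_graphMap, apply_graphMap]
    simp only
    linarith
  · rintro ⟨hx, hmax⟩
    have h1 := hmax _ (graphMap_mem hvm.1)
    rw [hl', hl', gap_graphMap, apply_graphMap] at h1
    simp only at h1
    have h2 := hN' x hx
    have h3 := gap_nonneg hS hx
    have h0 : gap e h x = 0 := by linarith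
    refine ⟨(e x).1, hm.superset ⟨fst_mem_convexHull_contact hS hx h0, fun z hz => ?_⟩,
      graphMap_of_gap_eq_zero h0⟩
    have := hvm.2 z hz
    rw [h0] at h1
    linarith

theorem bddAbove_fiber (hP : IsCompact P) (y : V) : BddAbove {t | e.symm (y, t) ∈ P} := by
  obtain ⟨M, hM⟩ := (hP.image (f := fun x => (e x).2) (by fun_prop)).bddAbove
  exact ⟨M, fun t ht => hM ⟨_, ht, by simp⟩⟩

theorem isClosed_fiber (hP : IsCompact P) (y : V) : IsClosed {t : ℝ | e.symm (y, t) ∈ P} :=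
  hP.isClosed.preimage (by fun_prop)

theorem fiber_nonempty {y : V} (hy : y ∈ shadow P e) : {t : ℝ | e.symm (y, t) ∈ P}.Nonempty := by
  obtain ⟨x, hx, rfl⟩ := hy
  exact ⟨(e x).2, by simpa using hx⟩

theorem upper_mem (hP : IsCompact P) {y : V} (hy : y ∈ shadow P e) :
    e.symm (y, upper P e y) ∈ P :=
  (isClosed_fiber hP y).csSup_mem (fiber_nonempty hy) (bddAbove_fiber hP y)

theorem le_upper (hP : IsCompact P) {y : V} {t : ℝ} (ht : e.symm (y, t) ∈ P) :
    t ≤ upper P e y :=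
  le_csSup (bddAbove_fiber hP y) ht

theorem upper_eq (hfin : S.Finite) (hS : ∀ s ∈ S, 0 ≤ gap e h s) {y : V}
    (hy : y ∈ convexHull ℝ (contact S e h)) :
    upper (convexHull ℝ S) e y = h.1 y + h.2 := by
  have hc := hfin.isCompact_convexHull ℝ
  apply le_antisymm
  · have := gap_nonneg hS (upper_mem hc (convexHull_contact_subset hy))
    simp [gap] at this
    linarith
  · apply le_upper hc
    rw [← graphMap_apply]
    exact graphMap_mem hy

/-- A supporting hyperplane of a compact convex set at an upper boundary point over the interior
of the base. -/
theorem exists_support (hP : IsCompact P) (hconv : Convex ℝ P) {y : V}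
    (hy : y ∈ interior (shadow P e)) :
    ∃ h : StrongDual ℝ V × ℝ, (∀ x ∈ P, 0 ≤ gap e h x) ∧ h.1 y + h.2 = upper P e y := by
  have hyP := interior_subset hy
  -- The hypograph of the upper boundary has nonempty interior even when `P` does not.
  set D : Set (V × ℝ) := {z | ∃ x ∈ P, (e x).1 = z.1 ∧ z.2 ≤ (e x).2} with hD
  have hDconv : Convex ℝ D := by
    rintro z ⟨x, hx, hx1, hx2⟩ z' ⟨x', hx', hx1', hx2'⟩ a b ha hb hab
    refine ⟨a • x + b • x', hconv hx hx' ha hb hab, ?_, ?_⟩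
    · simp [hx1, hx1']
    · simp only [map_add, map_smul, Prod.snd_add, Prod.smul_snd, smul_eq_mul]
      gcongr
  obtain ⟨m, hm⟩ := (hP.image (f := fun x => (e x).2) (by fun_prop)).bddBelow
  have hq : (y, m - 1) ∈ interior D := by
    rw [mem_interior]
    refine ⟨interior (shadow P e) ×ˢ Set.Iio m, ?_, isOpen_interior.prod isOpen_Iio,
      hy, by simp⟩
    rintro ⟨z, t⟩ ⟨hz, ht⟩
    obtain ⟨x, hx, hxz⟩ := interior_subset hz
    exact ⟨x, hx, hxz, (le_of_lt ht).trans (hm ⟨x, hx, rfl⟩)⟩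
  have hp : (y, upper P e y) ∉ interior D := by
    intro hmem
    have hcont : Filter.Tendsto (fun t : ℝ => (y, t)) (nhdsWithin (upper P e y) (Set.Ioi (upper P e y)))
        (nhds (y, upper P e y)) :=
      ((by fun_prop : Continuous fun t : ℝ => (y, t)).tendsto _).mono_left nhdsWithin_le_nhds
    have hev := hcont.eventually (isOpen_interior.mem_nhds hmem)
    obtain ⟨t, ht, ht'⟩ := (hev.and self_mem_nhdsWithin).exists
    obtain ⟨x, hx, hx1, hx2⟩ := interior_subset ht
    have : (e x).2 ≤ upper P e y := le_upper hP (by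
      rw [show (y, (e x).2) = e x from Prod.ext hx1.symm rfl]; simpa using hx)
    exact absurd (hx2.trans this) (not_le.2 ht')
  obtain ⟨f, hf⟩ := geometric_hahn_banach_open_point hDconv.interior isOpen_interior hp
  have hle : ∀ z ∈ D, f z ≤ f (y, upper P e y) := by
    intro z hz
    have hz' : z ∈ closure (interior D) := by
      rw [hDconv.closure_interior_eq_closure_of_nonempty_interior ⟨_, hq⟩]
      exact subset_closure hz
    exact closure_minimal (fun a ha => (hf a ha).le)
      (isClosed_le f.continuous continuous_const) hz'
  have hsplit : ∀ z : V × ℝ, f z = f (z.1, 0) + z.2 * f (0, 1) := by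
    intro z
    conv_lhs => rw [show z = (z.1, 0) + z.2 • ((0, 1) : V × ℝ) by ext <;> simp]
    rw [map_add, map_smul, smul_eq_mul]
  have hmu : m ≤ upper P e y := by
    have := hm ⟨_, upper_mem hP hyP, rfl⟩
    simpa using this
  -- The interior point `(y, m - 1)` lies straight below the boundary point, so the separating
  -- hyperplane is not vertical and can be solved for the height.
  have hpos : 0 < f (0, 1) := by
    have h1 := hf _ hq
    rw [hsplit (y, m - 1), hsplit (y, upper P e y)] at h1
    simp only at h1
    by_contra hneg
    nlinarith
  set τ := f (0, 1) with hτ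
  refine ⟨(-τ⁻¹ • f.comp (ContinuousLinearMap.inl ℝ V ℝ), τ⁻¹ * f (y, upper P e y)), ?_, ?_⟩
  · intro x hx
    have h1 := hle (e x) ⟨x, hx, rfl, le_rfl⟩
    rw [hsplit (e x)] at h1
    have : τ * gap e (-τ⁻¹ • f.comp (ContinuousLinearMap.inl ℝ V ℝ), τ⁻¹ * f (y, upper P e y)) x
        = f (y, upper P e y) - (f ((e x).1, 0) + (e x).2 * τ) := by
      simp [gap]
      field_simp
      ring
    have h2 : 0 ≤ τ * gap e (-τ⁻¹ • f.comp (ContinuousLinearMap.inl ℝ V ℝ),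
      τ⁻¹ * f (y, upper P e y)) x := by rw [this]; linarith
    exact nonneg_of_mul_nonneg_right h2 hpos
  · rw [hsplit (y, upper P e y)]
    simp
    field_simp
    ring

theorem contact_finite (hfin : S.Finite) (h : StrongDual ℝ V × ℝ) : (contact S e h).Finite :=
  (hfin.subset fun _ hs => hs.1).image _

theorem isCompact_shadow (hP : IsCompact P) : IsCompact (shadow P e) :=
  hP.image (by fun_prop)

/-- Reverse the vertical coordinate. -/
noncomputable def flip (e : E ≃L[ℝ] V × ℝ) : E ≃L[ℝ] V × ℝ :=
  e.trans ((ContinuousLinearEquiv.refl ℝ V).prodCongr (ContinuousLinearEquiv.neg ℝ))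

theorem flip_apply (x : E) : flip e x = ((e x).1, -(e x).2) := rfl

theorem flip_symm_apply (y : V) (t : ℝ) : (flip e).symm (y, t) = e.symm (y, -t) := by
  rw [ContinuousLinearEquiv.symm_apply_eq, flip_apply]
  simp

/-- Under `flip` the lower boundary becomes an upper one with opposite sign, so everything proved
for `upper` serves both ends. -/
theorem fiber_eq_Icc (hP : IsCompact P) (hconv : Convex ℝ P) {y : V} (hy : y ∈ shadow P e) :
    {t | e.symm (y, t) ∈ P} = Set.Icc (-upper P (flip e) y) (upper P e y) := by
  have hy' : y ∈ shadow P (flip e) := hy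
  have hl : e.symm (y, -upper P (flip e) y) ∈ P := by
    rw [← flip_symm_apply]
    exact upper_mem hP hy'
  have hord : Convex ℝ {t : ℝ | e.symm (y, t) ∈ P} := by
    intro s hs t ht a b ha hb hab
    have := hconv hs ht ha hb hab
    rw [← map_smul, ← map_smul, ← map_add] at this
    have h2 : a • (y, s) + b • (y, t) = (y, a • s + b • t) := by
      ext
      · simp [← add_smul, hab]
      · simp
    rw [h2] at this
    exact this
  ext t
  constructor
  · intro ht
    refine ⟨?_, le_upper hP ht⟩
    have := le_upper (e := flip e) (y := y) (t := -t) hP (by rw [flip_symm_apply, neg_neg]; exact ht)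
    linarith
  · intro ht
    exact hord.ordConnected.out hl (upper_mem hP hy) ht

end Facets

/-! ### Decomposition of the shadow into facets, and Fubini -/

section Integration

variable {E V : Type*} [NormedAddCommGroup E] [NormedSpace ℝ E]
  [NormedAddCommGroup V] [NormedSpace ℝ V] [FiniteDimensional ℝ V]
  [MeasurableSpace V] [BorelSpace V] {S P : Set E} {e : E ≃L[ℝ] V × ℝ}

/-- The affine functions whose graphs contain an upper facet of the convex hull of `S`. -/
def upperFacets (S : Set E) (e : E ≃L[ℝ] V × ℝ) (ν : Measure V) : Set (StrongDual ℝ V × ℝ) :=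
  {h | (∀ s ∈ S, 0 ≤ gap e h s) ∧ ν (convexHull ℝ (contact S e h)) ≠ 0}

variable (ν : Measure V) [ν.IsAddHaarMeasure]

theorem measure_affine_agree {h h' : StrongDual ℝ V × ℝ} (hne : h ≠ h') :
    ν {y | h.1 y + h.2 = h'.1 y + h'.2} = 0 := by
  set f : V →ᵃ[ℝ] ℝ := (h.1 - h'.1).toLinearMap.toAffineMap + AffineMap.const ℝ V (h.2 - h'.2)
  have hf : ∀ y, f y = (h.1 y + h.2) - (h'.1 y + h'.2) := by
    intro y
    simp [f]
    ring
  set A : AffineSubspace ℝ V := (AffineSubspace.mk' (0 : ℝ) ⊥).comap f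
  have hA : ∀ y, y ∈ A ↔ h.1 y + h.2 = h'.1 y + h'.2 := by
    intro y
    simp [A, hf, sub_eq_zero]
  have hset : {y | h.1 y + h.2 = h'.1 y + h'.2} = (A : Set V) := by
    ext y
    exact (hA y).symm
  rw [hset]
  apply Measure.addHaar_affineSubspace
  intro htop
  have hall : ∀ y, h.1 y + h.2 = h'.1 y + h'.2 := fun y => (hA y).1 (htop ▸ AffineSubspace.mem_top ℝ V y)
  have h2 : h.2 = h'.2 := by simpa using hall 0
  refine hne (Prod.ext (ContinuousLinearMap.ext fun y => ?_) h2)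
  have := hall y
  linarith

/-- On an overlap both affine functions equal `upper`, and distinct affine functions agree only on a
null set. -/
theorem upperFacets_aedisjoint (hfin : S.Finite) {h h' : StrongDual ℝ V × ℝ}
    (hh : h ∈ upperFacets S e ν) (hh' : h' ∈ upperFacets S e ν) (hne : h ≠ h') :
    AEDisjoint ν (convexHull ℝ (contact S e h)) (convexHull ℝ (contact S e h')) := by
  refine measure_mono_null ?_ (measure_affine_agree ν hne)
  rintro y ⟨hy, hy'⟩
  exact (upper_eq hfin hh.1 hy).symm.trans (upper_eq hfin hh'.1 hy')

/-- A facet is determined by the points of `S` it touches: two with the same contact set would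
overlap in a non-null set. -/
theorem upperFacets_finite (hfin : S.Finite) : (upperFacets S e ν).Finite := by
  refine Set.Finite.of_injOn (f := fun h => {s | s ∈ S ∧ gap e h s = 0}) (t := S.powerset)
    (fun h _ s hs => hs.1) ?_ hfin.finite_subsets
  intro h hh h' hh' heq
  by_contra hne
  have hc : contact S e h = contact S e h' := congrArg (fun T => (fun x => (e x).1) '' T) heq
  have := upperFacets_aedisjoint ν hfin hh hh' hne
  rw [AEDisjoint, hc, Set.inter_self] at this
  exact hh'.2 this

/-- Off the frontier of the shadow there is a supporting graph. Its contact set projects a subset of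
`S`; the finitely many such projections with null hull are discarded too. -/
theorem ae_exists_upperFacet (hfin : S.Finite) :
    ∀ᵐ y ∂ν, y ∈ shadow (convexHull ℝ S) e →
      ∃ h ∈ upperFacets S e ν, y ∈ convexHull ℝ (contact S e h) := by
  have hc := hfin.isCompact_convexHull ℝ
  have h1 : ∀ᵐ y ∂ν, y ∉ frontier (shadow (convexHull ℝ S) e) :=
    measure_eq_zero_iff_ae_notMem.1
      ((convex_shadow (convex_convexHull ℝ S)).addHaar_frontier ν)
  have h2 : ∀ᵐ y ∂ν, ∀ T ∈ S.powerset, ν (convexHull ℝ ((fun x => (e x).1) '' T)) = 0 →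
      y ∉ convexHull ℝ ((fun x => (e x).1) '' T) := by
    refine (ae_ball_iff hfin.finite_subsets.countable).2 ?_
    intro T _
    by_cases h0 : ν (convexHull ℝ ((fun x => (e x).1) '' T)) = 0
    · filter_upwards [measure_eq_zero_iff_ae_notMem.1 h0] with y hy _ using hy
    · exact Filter.Eventually.of_forall fun _ h => absurd h h0
  filter_upwards [h1, h2] with y hy1 hy2 hy
  have hint : y ∈ interior (shadow (convexHull ℝ S) e) := by
    by_contra hni
    exact hy1 ⟨subset_closure hy, hni⟩
  obtain ⟨h, hh, hy0⟩ := exists_support hc (convex_convexHull ℝ S) hint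
  have hS : ∀ s ∈ S, 0 ≤ gap e h s := fun s hs => hh s (subset_convexHull ℝ S hs)
  have hmem : y ∈ convexHull ℝ (contact S e h) := by
    have := fst_mem_convexHull_contact hS (upper_mem hc hy) (by simp [gap, hy0])
    simpa using this
  exact ⟨h, ⟨hS, fun h0 => hy2 _ (fun s hs => hs.1) h0 hmem⟩, hmem⟩

theorem shadow_ae_eq (hfin : S.Finite) :
    shadow (convexHull ℝ S) e =ᵐ[ν]
      ⋃ h : upperFacets S e ν, convexHull ℝ (contact S e h.1) := by
  filter_upwards [ae_exists_upperFacet (e := e) ν hfin] with y hy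
  refine propext ⟨fun hm => ?_, fun hm => ?_⟩
  · obtain ⟨h, hh, hyh⟩ := hy hm
    exact Set.mem_iUnion.2 ⟨⟨h, hh⟩, hyh⟩
  · obtain ⟨h, hyh⟩ := Set.mem_iUnion.1 hm
    exact convexHull_contact_subset hyh

theorem setIntegral_upper_eq_zero (hfin : S.Finite)
    (hz : ∀ h ∈ upperFacets S e ν, ∫ y in convexHull ℝ (contact S e h),
      Complex.exp (Complex.I * ((h.1 y + h.2 : ℝ) : ℂ)) ∂ν = 0) :
    IntegrableOn (fun y => Complex.exp (Complex.I * (upper (convexHull ℝ S) e y : ℂ)))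
      (shadow (convexHull ℝ S) e) ν ∧
    ∫ y in shadow (convexHull ℝ S) e,
      Complex.exp (Complex.I * (upper (convexHull ℝ S) e y : ℂ)) ∂ν = 0 := by
  have : Finite (upperFacets S e ν) := upperFacets_finite ν hfin
  have hcpt : ∀ h : upperFacets S e ν, IsCompact (convexHull ℝ (contact S e h.1)) :=
    fun h => (contact_finite hfin h.1).isCompact_convexHull ℝ
  have heq : ∀ h : upperFacets S e ν, Set.EqOn
      (fun y => Complex.exp (Complex.I * (upper (convexHull ℝ S) e y : ℂ)))
      (fun y => Complex.exp (Complex.I * ((h.1.1 y + h.1.2 : ℝ) : ℂ)))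
      (convexHull ℝ (contact S e h.1)) := by
    intro h y hy
    simp only
    rw [upper_eq hfin h.2.1 hy]
  have hint : IntegrableOn (fun y => Complex.exp (Complex.I * (upper (convexHull ℝ S) e y : ℂ)))
      (⋃ h : upperFacets S e ν, convexHull ℝ (contact S e h.1)) ν := by
    rw [integrableOn_finite_iUnion]
    intro h
    rw [integrableOn_congr_fun (heq h) (hcpt h).measurableSet]
    exact (by fun_prop : Continuous fun y => Complex.exp
      (Complex.I * ((h.1.1 y + h.1.2 : ℝ) : ℂ))).continuousOn.integrableOn_compact (hcpt h)
  refine ⟨hint.congr_set_ae (shadow_ae_eq ν hfin), ?_⟩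
  rw [setIntegral_congr_set (shadow_ae_eq ν hfin),
    integral_iUnion_ae (fun h => (hcpt h).measurableSet.nullMeasurableSet)
      (fun h h' hne => upperFacets_aedisjoint ν hfin h.2 h'.2 (Subtype.coe_ne_coe.2 hne)) hint]
  refine (tsum_congr fun h => ?_).trans tsum_zero
  rw [setIntegral_congr_fun (hcpt h).measurableSet (heq h)]
  exact hz h.1 h.2

variable [MeasurableSpace E] [BorelSpace E]

/-- The constant `c` compares Haar measures, since the splitting need not preserve volume; its value
is immaterial to a vanishing integral. -/
theorem setIntegral_exp_snd (μ : Measure E) [μ.IsAddHaarMeasure] (hP : IsCompact P)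
    (hconv : Convex ℝ P) :
    ∃ c : NNReal,
    ∫ x in P, Complex.exp (Complex.I * ((e x).2 : ℂ)) ∂μ =
      c • ∫ y in shadow P e, (Complex.exp (Complex.I * (upper P e y : ℂ))
        - Complex.exp (Complex.I * ((-upper P (flip e) y : ℝ) : ℂ))) / Complex.I ∂ν := by
  have hHaar : (μ.map e).IsAddHaarMeasure := e.isAddHaarMeasure_map μ
  obtain ⟨c, hc⟩ : ∃ c : NNReal, μ.map e = c • ν.prod volume :=
    ⟨_, Measure.isAddLeftInvariant_eq_smul _ _⟩
  refine ⟨c, ?_⟩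
  set Q : Set (V × ℝ) := e.symm ⁻¹' P
  have hQ : IsCompact Q := by
    rw [show Q = e '' P from (e.image_eq_preimage_symm P).symm]
    exact hP.image e.continuous
  have h1 : ∫ x in P, Complex.exp (Complex.I * ((e x).2 : ℂ)) ∂μ =
      ∫ z in Q, Complex.exp (Complex.I * (z.2 : ℂ)) ∂(μ.map e) := by
    have hemb : MeasurableEmbedding e := e.toHomeomorph.measurableEmbedding
    rw [hemb.setIntegral_map, show e ⁻¹' Q = P by ext; simp [Q]]
  rw [h1, hc, Measure.restrict_smul, integral_smul_nnreal_measure]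
  congr 1
  rw [← integral_indicator hQ.measurableSet, ← integral_indicator (isCompact_shadow hP).measurableSet,
    integral_prod]
  · congr 1
    ext y
    have hslice : ∀ t : ℝ, Q.indicator (fun z : V × ℝ => Complex.exp (Complex.I * (z.2 : ℂ))) (y, t)
        = {t : ℝ | e.symm (y, t) ∈ P}.indicator (fun t => Complex.exp (Complex.I * (t : ℂ))) t :=
      fun t => rfl
    simp_rw [hslice]
    rw [integral_indicator (isClosed_fiber hP y).measurableSet]
    by_cases hy : y ∈ shadow P e
    · rw [Set.indicator_of_mem hy, fiber_eq_Icc hP hconv hy, integral_Icc_eq_integral_Ioc,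
        ← intervalIntegral.integral_of_le, integral_exp_mul_complex Complex.I_ne_zero]
      have hne := fiber_nonempty hy
      rw [fiber_eq_Icc hP hconv hy] at hne
      exact Set.nonempty_Icc.1 hne
    · rw [Set.indicator_of_notMem hy]
      have : {t : ℝ | e.symm (y, t) ∈ P} = ∅ := by
        ext t
        simp only [Set.mem_ofPred_eq, Set.mem_empty_iff_false, iff_false]
        exact fun ht => hy ⟨_, ht, by simp⟩
      simp [this]
  · rw [integrable_indicator_iff hQ.measurableSet]
    exact (by fun_prop : Continuous fun z : V × ℝ => Complex.exp
      (Complex.I * (z.2 : ℂ))).continuousOn.integrableOn_compact hQ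

end Integration

/-! ### Vanishing of the exponential integral by induction on dimension -/

section Induction

theorem exists_splitting {E : Type*} [NormedAddCommGroup E] [NormedSpace ℝ E]
    [FiniteDimensional ℝ E] {ω : StrongDual ℝ E} (hω : ω ≠ 0) :
    ∃ e : E ≃L[ℝ] ω.toLinearMap.ker × ℝ, ∀ x, (e x).2 = ω x := by
  obtain ⟨a, ha⟩ : ∃ a, ω a = 1 := by
    obtain ⟨b, hb⟩ := DFunLike.ne_iff.1 hω
    exact ⟨(ω b)⁻¹ • b, by simpa using inv_mul_cancel₀ hb⟩
  let f : E →ₗ[ℝ] ω.toLinearMap.ker × ℝ :=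
    LinearMap.prod ((LinearMap.id - ω.toLinearMap.smulRight a).codRestrict _ fun x => by
      simp [ha]) ω.toLinearMap
  have hf : ∀ x, f x = (⟨x - ω x • a, by simp [ha]⟩, ω x) := fun x => rfl
  let g : ω.toLinearMap.ker × ℝ →ₗ[ℝ] E :=
    LinearMap.coprod (Submodule.subtype _) (LinearMap.toSpanSingleton ℝ E a)
  have hg : ∀ z, g z = (z.1 : E) + z.2 • a := fun z => by simp [g]
  refine ⟨(LinearEquiv.ofLinearMap f g ?_ ?_).toContinuousLinearEquiv, fun x => rfl⟩
  · refine LinearMap.ext fun z => ?_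
    have h1 : ω (z.1 : E) = 0 := z.1.2
    rw [LinearMap.comp_apply, hf, hg]
    ext
    · simp [h1, ha]
    · simp [h1, ha]
  · refine LinearMap.ext fun x => ?_
    rw [LinearMap.comp_apply, hg, hf]
    simp

theorem finrank_ker_add_one {E : Type*} [NormedAddCommGroup E] [NormedSpace ℝ E]
    [FiniteDimensional ℝ E] {ω : StrongDual ℝ E} (hω : ω ≠ 0) :
    Module.finrank ℝ ω.toLinearMap.ker + 1 = Module.finrank ℝ E := by
  obtain ⟨e, -⟩ := exists_splitting hω
  rw [e.toLinearEquiv.finrank_eq, Module.finrank_prod, Module.finrank_self]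

section Base

variable {E V : Type*} [NormedAddCommGroup E] [NormedSpace ℝ E]
  [NormedAddCommGroup V] [NormedSpace ℝ V] {P : Set E} {e : E ≃L[ℝ] V × ℝ}

theorem upper_mem_extremePoints [Subsingleton V] (hP : IsCompact P) {y : V}
    (hy : y ∈ shadow P e) : e.symm (y, upper P e y) ∈ P.extremePoints ℝ := by
  rw [mem_extremePoints]
  refine ⟨upper_mem hP hy, ?_⟩
  rintro x hx z hz ⟨a, b, ha, hb, hab, hc⟩
  have key : ∀ x, x = e.symm (y, (e x).2) := fun x => by
    rw [e.eq_symm_apply]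
    exact Prod.ext (Subsingleton.elim _ _) rfl
  have h1 : (e x).2 ≤ upper P e y := le_upper hP (by rwa [← key])
  have h2 : (e z).2 ≤ upper P e y := le_upper hP (by rwa [← key])
  have h3 := congrArg (fun q => (e q).2) hc
  simp only [map_add, map_smul, Prod.snd_add, Prod.smul_snd, smul_eq_mul,
    ContinuousLinearEquiv.apply_symm_apply] at h3
  have h4 := mul_le_mul_of_nonneg_left h1 ha.le
  have h5 := mul_le_mul_of_nonneg_left h2 hb.le
  have h6 : a * upper P e y + b * upper P e y = upper P e y := by rw [← add_mul, hab, one_mul]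
  have e1 : (e x).2 = upper P e y := mul_left_cancel₀ ha.ne' (by linarith)
  have e2 : (e z).2 = upper P e y := mul_left_cancel₀ hb.ne' (by linarith)
  exact ⟨by rw [← e1, ← key], by rw [← e2, ← key]⟩

theorem lower_mem_extremePoints [Subsingleton V] (hP : IsCompact P) {y : V}
    (hy : y ∈ shadow P e) : e.symm (y, -upper P (flip e) y) ∈ P.extremePoints ℝ := by
  rw [← flip_symm_apply]
  exact upper_mem_extremePoints hP hy

theorem eq_segment_of_subsingleton [Subsingleton V] (hP : IsCompact P) (hconv : Convex ℝ P)
    {y : V} (hy : y ∈ shadow P e) :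
    P = segment ℝ (e.symm (y, -upper P (flip e) y)) (e.symm (y, upper P e y)) := by
  refine Set.Subset.antisymm (fun x hx => ?_)
    (hconv.segment_subset (lower_mem_extremePoints hP hy).1 (upper_mem_extremePoints hP hy).1)
  have hxe : x = e.symm (y, (e x).2) := by
    rw [e.eq_symm_apply]
    exact Prod.ext (Subsingleton.elim _ _) rfl
  have hmem : (e x).2 ∈ {t | e.symm (y, t) ∈ P} := by
    rw [Set.mem_ofPred_eq, ← hxe]
    exact hx
  rw [fiber_eq_Icc hP hconv hy] at hmem
  rw [← segment_eq_Icc (hmem.1.trans hmem.2)] at hmem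
  obtain ⟨a, b, ha, hb, hab, hc⟩ := hmem
  refine ⟨a, b, ha, hb, hab, ?_⟩
  rw [hxe, ← hc, ← map_smul, ← map_smul, ← map_add]
  congr 1
  exact Prod.ext (Subsingleton.elim _ _) rfl

end Base

/-- Descending through upper facets of positive measure reaches a segment. An edge is needed so that
separating edge endpoints forces `ω ≠ 0`. -/
theorem exists_isEdge (n : ℕ) {E : Type*} [NormedAddCommGroup E] [NormedSpace ℝ E]
    [FiniteDimensional ℝ E] [MeasurableSpace E] [BorelSpace E] (μ : Measure E)
    [μ.IsAddHaarMeasure] (hn : Module.finrank ℝ E = n + 1) {S : Set E} (hfin : S.Finite)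
    (hμ : μ (convexHull ℝ S) ≠ 0) : ∃ v w, IsEdge (convexHull ℝ S) v w := by
  have hc := hfin.isCompact_convexHull ℝ
  have hconv := convex_convexHull ℝ S
  have : Nontrivial E := Module.nontrivial_of_finrank_pos (R := ℝ) (by omega)
  obtain ⟨ω, hω⟩ := exists_ne (0 : StrongDual ℝ E)
  obtain ⟨e, -⟩ := exists_splitting hω
  have hrank := finrank_ker_add_one hω
  induction n generalizing E with
  | zero =>
    have : Subsingleton ω.toLinearMap.ker :=
      Module.finrank_zero_iff (R := ℝ).1 (by omega)
    obtain ⟨x, hx⟩ := nonempty_of_measure_ne_zero hμ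
    have hy : (e x).1 ∈ shadow (convexHull ℝ S) e := ⟨x, hx, rfl⟩
    have hseg := eq_segment_of_subsingleton hc hconv hy
    refine ⟨_, _, lower_mem_extremePoints hc hy, upper_mem_extremePoints hc hy, fun heq => ?_, ?_⟩
    · rw [heq, segment_same] at hseg
      rw [hseg] at hμ
      exact hμ (measure_singleton _)
    · rw [← hseg]
  | succ n ih =>
    set ν : Measure ω.toLinearMap.ker := Measure.addHaar
    -- Otherwise the polytope would lie in a null cylinder.
    have hsh : ν (shadow (convexHull ℝ S) e) ≠ 0 := by
      intro h0
      apply hμ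
      obtain ⟨c, hcm⟩ : ∃ c : NNReal, μ.map e = c • ν.prod volume :=
        letI := e.isAddHaarMeasure_map μ
        ⟨_, Measure.isAddLeftInvariant_eq_smul (μ.map e) (ν.prod volume)⟩
      have hemb : MeasurableEmbedding e := e.toHomeomorph.measurableEmbedding
      have h1 : μ.map e (shadow (convexHull ℝ S) e ×ˢ Set.univ) = 0 := by
        rw [hcm, Measure.smul_apply, Measure.prod_prod, h0, zero_mul, smul_zero]
      rw [hemb.map_apply] at h1
      refine measure_mono_null (fun x hx => ?_) h1
      exact ⟨⟨x, hx, rfl⟩, trivial⟩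
    obtain ⟨h, hh⟩ : (upperFacets S e ν).Nonempty := by
      by_contra hne
      rw [Set.not_nonempty_iff_eq_empty] at hne
      apply hsh
      rw [measure_eq_zero_iff_ae_notMem]
      filter_upwards [ae_exists_upperFacet (e := e) ν hfin] with y hy hym
      obtain ⟨h, hh, -⟩ := hy hym
      rw [hne] at hh
      exact hh
    have hV : Module.finrank ℝ ω.toLinearMap.ker = n + 1 := by omega
    have hfin' := contact_finite (e := e) hfin h
    have : Nontrivial ω.toLinearMap.ker := Module.nontrivial_of_finrank_pos (R := ℝ) (by omega)
    obtain ⟨ω', hω'⟩ := exists_ne (0 : StrongDual ℝ ω.toLinearMap.ker)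
    obtain ⟨e', -⟩ := exists_splitting hω'
    obtain ⟨v, w, hvw⟩ := ih ν hV hfin' hh.2 (hfin'.isCompact_convexHull ℝ)
      (convex_convexHull ℝ _) this ω' hω' e' (finrank_ker_add_one hω')
    exact ⟨_, _, isEdge_graphMap hfin hh.1 hvw⟩

theorem exp_I_mul_neg (t : ℝ) :
    Complex.exp (Complex.I * ((-t : ℝ) : ℂ)) = conj (Complex.exp (Complex.I * (t : ℂ))) := by
  rw [← Complex.exp_conj]
  simp

/-- If `ω` separates the endpoints of every edge of a polytope and `exp (i ω)` is constant on its
vertices, then `exp (i ω)` integrates to zero on the polytope. -/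
theorem setIntegral_exp_eq_zero (n : ℕ) {E : Type*} [NormedAddCommGroup E] [NormedSpace ℝ E]
    [FiniteDimensional ℝ E] [MeasurableSpace E] [BorelSpace E] (μ : Measure E)
    [μ.IsAddHaarMeasure] (hn : Module.finrank ℝ E = n + 1) {S : Set E} (hfin : S.Finite)
    (ω : StrongDual ℝ E)
    (hvert : ∀ v ∈ (convexHull ℝ S).extremePoints ℝ, ∀ w ∈ (convexHull ℝ S).extremePoints ℝ,
      Complex.exp (Complex.I * (ω v : ℂ)) = Complex.exp (Complex.I * (ω w : ℂ)))
    (hedge : ∀ v w, IsEdge (convexHull ℝ S) v w → ω v ≠ ω w) :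
    ∫ x in convexHull ℝ S, Complex.exp (Complex.I * (ω x : ℂ)) ∂μ = 0 := by
  induction n generalizing E with
  | zero =>
    have hc := hfin.isCompact_convexHull ℝ
    have hconv := convex_convexHull ℝ S
    by_cases hμ : μ (convexHull ℝ S) = 0
    · rw [Measure.restrict_eq_zero.2 hμ, integral_zero_measure]
    obtain ⟨v, w, hvw⟩ := exists_isEdge 0 μ hn hfin hμ
    have hω : ω ≠ 0 := by
      rintro rfl
      exact hedge v w hvw rfl
    obtain ⟨e, he⟩ := exists_splitting hω
    have hrank := finrank_ker_add_one hω
    have : Subsingleton ω.toLinearMap.ker := Module.finrank_zero_iff (R := ℝ).1 (by omega)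
    simp_rw [← he]
    obtain ⟨c, h⟩ := setIntegral_exp_snd (e := e) Measure.addHaar μ hc hconv
    rw [h, setIntegral_congr_fun (g := 0) (isCompact_shadow hc).measurableSet]
    · simp
    · intro y hy
      have := hvert _ (upper_mem_extremePoints hc hy) _ (lower_mem_extremePoints hc hy)
      simp only [← he, ContinuousLinearEquiv.apply_symm_apply] at this
      simp [this]
  | succ n ih =>
    have hc := hfin.isCompact_convexHull ℝ
    have hconv := convex_convexHull ℝ S
    by_cases hμ : μ (convexHull ℝ S) = 0
    · rw [Measure.restrict_eq_zero.2 hμ, integral_zero_measure]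
    obtain ⟨v, w, hvw⟩ := exists_isEdge _ μ hn hfin hμ
    have hω : ω ≠ 0 := by
      rintro rfl
      exact hedge v w hvw rfl
    obtain ⟨e, he⟩ := exists_splitting hω
    have hrank := finrank_ker_add_one hω
    -- Stated for any splitting `e'`, so that it applies to both `e` and `flip e`.
    have facet : ∀ e' : E ≃L[ℝ] ω.toLinearMap.ker × ℝ,
        (∀ v ∈ (convexHull ℝ S).extremePoints ℝ, ∀ w ∈ (convexHull ℝ S).extremePoints ℝ,
          Complex.exp (Complex.I * ((e' v).2 : ℂ)) = Complex.exp (Complex.I * ((e' w).2 : ℂ))) →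
        (∀ v w, IsEdge (convexHull ℝ S) v w → (e' v).2 ≠ (e' w).2) →
        ∀ h ∈ upperFacets S e' Measure.addHaar, ∫ y in convexHull ℝ (contact S e' h),
          Complex.exp (Complex.I * ((h.1 y + h.2 : ℝ) : ℂ)) ∂Measure.addHaar = 0 := by
      intro e' hv' he' h hh
      have hI := ih Measure.addHaar (by omega) (contact_finite (e := e') hfin h) h.1 ?_ ?_
      · have hmul : ∀ y, Complex.exp (Complex.I * ((h.1 y + h.2 : ℝ) : ℂ)) =
            Complex.exp (Complex.I * (h.1 y : ℂ)) * Complex.exp (Complex.I * (h.2 : ℂ)) := by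
          intro y
          rw [← Complex.exp_add]
          push_cast
          ring_nf
        simp_rw [hmul]
        rw [integral_mul_const, hI, zero_mul]
      · intro v hv w hw
        have := hv' _ (graphMap_mem_extremePoints hh.1 hv) _ (graphMap_mem_extremePoints hh.1 hw)
        simp only [apply_graphMap] at this
        push_cast at this
        rw [mul_add, mul_add, Complex.exp_add, Complex.exp_add] at this
        exact mul_right_cancel₀ (Complex.exp_ne_zero _) this
      · intro v w hvw heq
        have := he' _ _ (isEdge_graphMap hfin hh.1 hvw)
        simp only [apply_graphMap] at this
        exact this (by rw [heq])
    obtain ⟨hint, hzero⟩ := setIntegral_upper_eq_zero Measure.addHaar hfin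
      (facet e (by simpa only [he] using hvert) (by simpa only [he] using hedge))
    obtain ⟨hint', hzero'⟩ := setIntegral_upper_eq_zero Measure.addHaar hfin
      (facet (flip e) (fun v hv w hw => by
        simp only [flip_apply, he, exp_I_mul_neg]
        rw [hvert v hv w hw]) (fun v w hvw => by
        simpa only [flip_apply, he, ne_eq, neg_inj] using hedge v w hvw))
    change IntegrableOn _ (shadow (convexHull ℝ S) e) _ at hint'
    change ∫ y in shadow (convexHull ℝ S) e, _ ∂_ = 0 at hzero'
    simp_rw [← he]
    obtain ⟨c, h⟩ := setIntegral_exp_snd (e := e) Measure.addHaar μ hc hconv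
    rw [h, integral_div, integral_sub hint]
    · simp_rw [exp_I_mul_neg]
      rw [integral_conj, hzero, hzero']
      simp
    · simp_rw [exp_I_mul_neg]
      exact Complex.conjLIE.toContinuousLinearEquiv.toContinuousLinearMap.integrable_comp hint'

end Induction

/-! ### Lattice points, greedy sequences and orthogonality -/

section Lattice

variable {d : ℕ} {P : Set (Euc d)} {n : ℕ}

theorem vertices_finite (hP : IsConvexPolytope P) : (vertices P).Finite := by
  obtain ⟨⟨S, hS, rfl⟩, -⟩ := hP
  exact hS.subset extremePoints_convexHull_subset

theorem edgeHyperplanes_finite (hP : IsConvexPolytope P) : (edgeHyperplanes P).Finite := by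
  have hv := vertices_finite hP
  refine (Set.Finite.image2 (fun v w : Euc d => {ω : Euc d | inner ℝ (w - v) ω = 0}) hv hv).subset ?_
  rintro H ⟨v, w, hvw, rfl⟩
  exact ⟨v, hvw.1, w, hvw.2.1, rfl⟩

theorem exists_isCommonDenominator (hP : IsConvexPolytope P) (hrat : IsRational P) :
    ∃ n : ℕ, IsCommonDenominator P n := by
  have : ∀ (v : Euc d) (i : Fin d), ∃ q : ℚ, v ∈ vertices P → v i = (q : ℝ) := by
    intro v i
    by_cases hv : v ∈ vertices P
    · obtain ⟨q, hq⟩ := hrat v hv i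
      exact ⟨q, fun _ => hq⟩
    · exact ⟨0, fun h => absurd h hv⟩
  choose q hq using this
  set N : ℕ := ∏ v ∈ (vertices_finite hP).toFinset, ∏ i, (q v i).den with hN
  have hN0 : 0 < N := Finset.prod_pos fun v _ => Finset.prod_pos fun i _ => (q v i).den_pos
  refine ⟨N, hN0, fun v hv i => ?_⟩
  obtain ⟨k, hk⟩ : (q v i).den ∣ N :=
    (Finset.dvd_prod_of_mem (fun i => (q v i).den) (Finset.mem_univ i)).trans
      (Finset.dvd_prod_of_mem (fun v => ∏ i, (q v i).den) (by simpa using hv))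
  refine ⟨(q v i).num * k, ?_⟩
  have hk0 : (k : ℝ) ≠ 0 := by
    rintro h
    rw [Nat.cast_eq_zero.1 h, mul_zero] at hk
    omega
  have hd0 : ((q v i).den : ℝ) ≠ 0 := Nat.cast_ne_zero.2 (q v i).den_ne_zero
  rw [hq v i hv, hk, eq_div_iff (by push_cast; positivity), Rat.cast_def]
  push_cast
  field_simp

theorem sub_mem_scaledLattice {x y : Euc d} (hx : x ∈ scaledLattice d n)
    (hy : y ∈ scaledLattice d n) : x - y ∈ scaledLattice d n := by
  intro i
  obtain ⟨k, hk⟩ := hx i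
  obtain ⟨l, hl⟩ := hy i
  refine ⟨k - l, ?_⟩
  rw [PiLp.sub_apply, hk, hl]
  push_cast
  ring

/-- Lattice points on the moment curve. -/
noncomputable def momentPoint (d n m : ℕ) : Euc d :=
  WithLp.toLp 2 fun i => 2 * Real.pi * n * (m : ℝ) ^ (i.val + 1)

theorem momentPoint_apply (m : ℕ) (i : Fin d) :
    momentPoint d n m i = 2 * Real.pi * n * (m : ℝ) ^ (i.val + 1) := rfl

theorem momentPoint_mem (m : ℕ) : momentPoint d n m ∈ scaledLattice d n := fun i =>
  ⟨(m : ℤ) ^ (i.val + 1), by rw [momentPoint_apply]; push_cast; ring⟩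

theorem momentPoint_injective (hd : 1 ≤ d) (hn : 0 < n) :
    Function.Injective (momentPoint d n) := by
  intro a b hab
  have h := congrArg (fun x : Euc d => x ⟨0, hd⟩) hab
  simp only [momentPoint_apply, zero_add, pow_one] at h
  have : (2 * Real.pi * n : ℝ) ≠ 0 := by positivity
  exact_mod_cast mul_left_cancel₀ this h

/-- Along the moment curve the hyperplane equation is a nonzero polynomial in `m`. Exponents start
at 1, so the constant term coming from `y` cannot cancel a coordinate of `u`. -/
theorem finite_momentPoint_mem_hyperplane (hn : 0 < n) {u : Euc d} (hu : u ≠ 0) (y : Euc d) :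
    {m : ℕ | inner ℝ u (momentPoint d n m - y) = 0}.Finite := by
  set Q : Polynomial ℝ := ∑ i : Fin d, Polynomial.C (2 * Real.pi * n * u i) * Polynomial.X ^ (i.val + 1)
    - Polynomial.C (inner ℝ u y) with hQ
  obtain ⟨j, hj⟩ : ∃ j, u j ≠ 0 := by
    by_contra! h
    exact hu (PiLp.ext h)
  have hcoeff : Q.coeff (j.val + 1) = 2 * Real.pi * n * u j := by
    rw [hQ, Polynomial.coeff_sub, Polynomial.finsetSum_coeff, Polynomial.coeff_C_succ, sub_zero,
      Finset.sum_eq_single j]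
    · rw [Polynomial.coeff_C_mul_X_pow, if_pos rfl]
    · intro i _ hij
      rw [Polynomial.coeff_C_mul_X_pow, if_neg]
      intro h
      exact hij (Fin.ext (by omega))
    · simp
  have hQ0 : Q ≠ 0 := by
    intro h0
    rw [h0, Polynomial.coeff_zero] at hcoeff
    have : (2 * Real.pi * n : ℝ) ≠ 0 := by positivity
    exact mul_ne_zero this hj hcoeff.symm
  have heval : ∀ m : ℕ, Q.eval (m : ℝ) = inner ℝ u (momentPoint d n m - y) := by
    intro m
    rw [inner_sub_right, PiLp.inner_apply u (momentPoint d n m), hQ]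
    simp only [Polynomial.eval_sub, Polynomial.eval_finsetSum, Polynomial.eval_mul,
      Polynomial.eval_C, Polynomial.eval_pow, Polynomial.eval_X, momentPoint_apply,
      RCLike.inner_apply, conj_trivial]
    congr 1
    exact Finset.sum_congr rfl fun i _ => by ring
  refine ((Polynomial.finite_setOfPred_isRoot hQ0).preimage
    (Nat.cast_injective.injOn (s := (Nat.cast : ℕ → ℝ) ⁻¹' {x | Q.IsRoot x}))).subset ?_
  intro m hm
  exact (heval m).trans hm

theorem admissible_infinite (hd : 1 ≤ d) (hP : IsConvexPolytope P) (hn : 0 < n)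
    {F : Set (Euc d)} (hF : F.Finite) : (admissible P n F).Infinite := by
  have hbad : (⋃ y ∈ F, ⋃ H ∈ edgeHyperplanes P, {m : ℕ | momentPoint d n m - y ∈ H}).Finite := by
    refine hF.biUnion fun y _ => (edgeHyperplanes_finite hP).biUnion ?_
    rintro H ⟨v, w, hvw, rfl⟩
    exact finite_momentPoint_mem_hyperplane hn (sub_ne_zero.2 hvw.2.2.1.symm) y
  refine (hbad.infinite_compl.image (momentPoint_injective hd hn).injOn).mono ?_
  rintro _ ⟨m, hm, rfl⟩
  refine ⟨momentPoint_mem m, fun y hy H hH hmem => hm ?_⟩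
  exact Set.mem_biUnion hy (Set.mem_biUnion hH hmem)

theorem exists_greedy (hd : 1 ≤ d) (hP : IsConvexPolytope P) (hn : 0 < n) :
    ∃ x : ℕ → Euc d, x 0 = 0 ∧ IsGreedy P n x := by
  -- Admissibility relative to `{0}` is built in so that `0` can be prepended.
  obtain ⟨f, hf1, hf2⟩ := exists_seq_of_forall_finset_exists
    (fun x : Euc d => x ∈ admissible P n {0})
    (fun y x => ∀ H ∈ edgeHyperplanes P, x - y ∉ H) (fun s _ => by
      obtain ⟨x, hx⟩ := (admissible_infinite hd hP hn
        ((Set.finite_singleton (0 : Euc d)).union s.finite_toSet)).nonempty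
      exact ⟨x, ⟨hx.1, fun y hy => hx.2 y (Or.inl hy)⟩, fun y hy => hx.2 y (Or.inr hy)⟩)
  refine ⟨fun k => Nat.casesOn k 0 f, rfl, fun k => ?_⟩
  cases k with
  | zero =>
    refine ⟨fun i => ⟨0, by simp⟩, ?_⟩
    rintro y ⟨j, hj, -⟩
    omega
  | succ k =>
    refine ⟨(hf1 k).1, ?_⟩
    rintro y ⟨j, hj, rfl⟩
    cases j with
    | zero => exact (hf1 k).2 0 rfl
    | succ j => exact hf2 j k (by omega)

theorem inner_vertex_mem (hn : IsCommonDenominator P n) {z v : Euc d}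
    (hz : z ∈ scaledLattice d n) (hv : v ∈ vertices P) :
    ∃ k : ℤ, inner ℝ z v = k * (2 * Real.pi) := by
  choose k hk using hz
  choose m hm using hn.2 v hv
  refine ⟨∑ i, k i * m i, ?_⟩
  have hn0 : (n : ℝ) ≠ 0 := Nat.cast_ne_zero.2 hn.1.ne'
  rw [PiLp.inner_apply]
  push_cast
  rw [Finset.sum_mul]
  refine Finset.sum_congr rfl fun i _ => ?_
  rw [RCLike.inner_apply, conj_trivial, hk, hm]
  field_simp

theorem setIntegral_exp_inner_eq_zero (hd : 1 ≤ d) (hP : IsConvexPolytope P)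
    (hn : IsCommonDenominator P n) {z : Euc d} (hz : z ∈ scaledLattice d n)
    (hH : ∀ H ∈ edgeHyperplanes P, z ∉ H) :
    ∫ x in P, Complex.exp (Complex.I * ((inner ℝ z x : ℝ) : ℂ)) = 0 := by
  have hone : ∀ v ∈ vertices P, Complex.exp (Complex.I * ((inner ℝ z v : ℝ) : ℂ)) = 1 := by
    intro v hv
    obtain ⟨k, hk⟩ := inner_vertex_mem hn hz hv
    rw [hk, ← Complex.exp_int_mul_two_pi_mul_I k]
    push_cast
    ring_nf
  obtain ⟨⟨S, hS, rfl⟩, -⟩ := hP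
  refine setIntegral_exp_eq_zero (d - 1) volume (by rw [finrank_euclideanSpace_fin]; omega) hS
    (innerSL ℝ z) (fun v hv w hw => (hone v hv).trans (hone w hw).symm) ?_
  intro v w hvw heq
  refine hH _ ⟨v, w, hvw, rfl⟩ ?_
  rw [innerSL_apply_apply, innerSL_apply_apply, real_inner_comm, real_inner_comm w] at heq
  rw [Set.mem_ofPred_eq, inner_sub_left, heq, sub_self]

/-- Simplicity gives some vertex `d ≥ 1` neighbours. The resulting edge hyperplane contains `0`,
which is what forces greedy points to be distinct. -/
theorem exists_adjacent (hd : 1 ≤ d) (hP : IsConvexPolytope P) (hsimple : IsSimple P) :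
    ∃ v w, Adjacent P v w := by
  have hne : P.Nonempty := nonempty_of_measure_ne_zero hP.2.ne'
  have hc : IsCompact P := by
    obtain ⟨⟨S, hS, rfl⟩, -⟩ := hP
    exact hS.isCompact_convexHull ℝ
  obtain ⟨v, hv⟩ := hc.extremePoints_nonempty hne
  have := hsimple v hv
  obtain ⟨w, hw⟩ : {w : Euc d | Adjacent P v w}.Nonempty := by
    rw [Set.nonempty_iff_ne_empty]
    intro h
    rw [h, Set.encard_empty] at this
    have : d = 0 := by exact_mod_cast this.symm
    omega
  exact ⟨v, w, hw⟩

theorem IsGreedy.sub_notMem {x : ℕ → Euc d} (hx : IsGreedy P n x) {j k : ℕ} (hjk : j ≠ k)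
    {H : Set (Euc d)} (hH : H ∈ edgeHyperplanes P) : x j - x k ∉ H := by
  rcases lt_or_gt_of_ne hjk with h | h
  · intro hmem
    refine (hx k).2 (x j) ⟨j, h, rfl⟩ H hH ?_
    -- Hyperplanes through the origin are symmetric, so the order of the two indices is irrelevant.
    obtain ⟨v, w, -, rfl⟩ := hH
    rw [Set.mem_ofPred_eq] at hmem ⊢
    rw [← neg_sub (x j), inner_neg_right, hmem, neg_zero]
  · exact (hx j).2 (x k) ⟨k, h, rfl⟩ H hH

theorem IsGreedy.injective (hd : 1 ≤ d) (hP : IsConvexPolytope P) (hsimple : IsSimple P)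
    {x : ℕ → Euc d} (hx : IsGreedy P n x) : Function.Injective x := by
  intro j k hjk
  by_contra hne
  obtain ⟨v, w, hvw⟩ := exists_adjacent hd hP hsimple
  refine hx.sub_notMem hne ⟨v, w, hvw, rfl⟩ ?_
  rw [Set.mem_ofPred_eq, hjk, sub_self, inner_zero_right]

theorem IsGreedy.isOrthogonalExponentials (hd : 1 ≤ d) (hP : IsConvexPolytope P)
    (hn : IsCommonDenominator P n) {x : ℕ → Euc d} (hx : IsGreedy P n x) :
    IsOrthogonalExponentials P (Set.range x) := by
  refine ⟨Set.countable_range x, ?_⟩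
  rintro _ ⟨j, rfl⟩ _ ⟨k, rfl⟩ hne
  have hjk : j ≠ k := fun h => hne (congrArg x h)
  rw [← setIntegral_exp_inner_eq_zero hd hP hn
    (sub_mem_scaledLattice (hx j).1 (hx k).1) fun H hH => hx.sub_notMem hjk hH]
  congr 1
  ext y
  rw [← exp_I_mul_neg, ← Complex.exp_add, inner_sub_left]
  push_cast
  ring_nf

end Lattice

end PolytopeExp

theorem theorem2p1 (d : ℕ) (hd : 1 ≤ d) (P : Set (PolytopeExp.Euc d))
    (hP : PolytopeExp.IsConvexPolytope P) (hsimple : PolytopeExp.IsSimple P)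
    (hrational : PolytopeExp.IsRational P) :
    (∃ Λ : Set (PolytopeExp.Euc d), Λ.Infinite ∧ PolytopeExp.IsOrthogonalExponentials P Λ) ∧
    (PolytopeExp.edgeHyperplanes P).Finite ∧
    (∃ n : ℕ, PolytopeExp.IsCommonDenominator P n) ∧
    ∀ n : ℕ, PolytopeExp.IsCommonDenominator P n →
      (∀ F : Set (PolytopeExp.Euc d), F.Finite → F ⊆ PolytopeExp.scaledLattice d n →
        (PolytopeExp.admissible P n F).Infinite) ∧
      (∃ x : ℕ → PolytopeExp.Euc d, x 0 = 0 ∧ PolytopeExp.IsGreedy P n x) ∧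
      (∀ x : ℕ → PolytopeExp.Euc d, PolytopeExp.IsGreedy P n x →
        Function.Injective x ∧
          PolytopeExp.IsOrthogonalExponentials P (Set.range x)) := by
  obtain ⟨n, hn⟩ := PolytopeExp.exists_isCommonDenominator hP hrational
  obtain ⟨x, -, hx⟩ := PolytopeExp.exists_greedy hd hP hn.1
  exact ⟨⟨_, Set.infinite_range_of_injective (hx.injective hd hP hsimple),
      hx.isOrthogonalExponentials hd hP hn⟩,
    PolytopeExp.edgeHyperplanes_finite hP, ⟨n, hn⟩,
    fun _ hm => ⟨fun _ hF _ => PolytopeExp.admissible_infinite hd hP hm.1 hF,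
      PolytopeExp.exists_greedy hd hP hm.1,
      fun _ hx => ⟨hx.injective hd hP hsimple, hx.isOrthogonalExponentials hd hP hm⟩⟩⟩
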